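/- Urn processes. An urn contains white and black balls. At each time $1,2,\dots$ a ball is drawn uniformly at random, independently of the previous draws, its colour is noted and it is put back. If the drawn ball is white, one black ball is replaced by a white one; if it is black, one white ball is replaced by a black one. The process stops as soon as all remaining balls have the same colour. Let $W_n,B_n$ be the numbers of white and black balls after $n$ draws and $H=\min\{n: W_n=0\text{ or }B_n=0\}$. For the process started from $w$ white and $b$ black balls put $V(w,b)=\mathbb E(B_H)$ and $T(w,b)=\mathbb E(H)$. The controlled process is obtained by applying Policy A at time $0$ and after every draw: if the number of white balls is at least the number of black balls, white balls are removed permanently until their number is one less than the number of black balls; otherwise nothing is done. $V^A(w,b)$ and $T^A(w,b)$ denote the expected final number of black balls and the expected time to absorption in the controlled process. Proposition. Fix $\tfrac12<x<1$ and, for $N\in\mathbb N$, let $b=\lceil xN\rceil$ and $w=\lfloor(1-x)N\rfloor$. Then the expected absorption times $T(w,b)$ and $T^A(w,b)$ are finite, and as $N\to\infty$ $$V^A(w,b)\sim V(w,b)\sim N,\qquad T^A(w,b)\sim T(w,b)\sim \frac N2\ln\Big(\frac1{2x-1}\Big),$$ where $f\sim g$ means $f/g\to1$. Moreover, if the controlled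 and the uncontrolled process are both started from $(w,b)$ and driven by the same random draws (each draw being selected by the same uniform random number in both processes), then the probability that they coincide at all times tends to $1$ as $N\to\infty$. -/

import Mathlib

open MeasureTheory Filter Asymptotics Topology

noncomputable section

namespace Mabinogion

/-- A content of the urn: (number of white balls, number of black balls). -/
abbrev State : Type := ℕ × ℕ

/-- All remaining balls have the same colour: there is no white ball or no black ball. -/
def Absorbed (s : State) : Prop := s.1 = 0 ∨ s.2 = 0

open Classical in
/-- One step of the urn. A number `u` uniform in `[0, 1]` selects one of the balls uniformly: the
drawn ball is white when `u * (white + black) < white`, hence with probability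
`white / (white + black)`, and black otherwise. If a white ball is drawn, a black ball is
replaced by a white one; if a black ball is drawn, a white ball is replaced by a black one.
The process has stopped once only one colour is left. -/
def step (s : State) (u : unitInterval) : State :=
  if Absorbed s then s
  else if (u : ℝ) * ((s.1 : ℝ) + (s.2 : ℝ)) < (s.1 : ℝ) then (s.1 + 1, s.2 - 1)
  else (s.1 - 1, s.2 + 1)

/-- Policy A: if there are at least as many white as black balls, reduce the number of white balls
to one less than the number of black balls; otherwise do nothing. (With no black ball in the urn
the process has stopped and nothing is removed.) -/
def policyA (s : State) : State :=
  if s.2 ≤ s.1 ∧ 0 < s.2 then (s.2 - 1, s.2) else s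

/-- The infinite sequences of random numbers that select the drawn balls;
entry `n` is used for the draw at time `n + 1`. -/
abbrev Draws : Type := ℕ → unitInterval

/-- The draws are independent and uniform. -/
def drawLaw : Measure Draws := Measure.infinitePi fun _ : ℕ => (volume : Measure unitInterval)

/-- The uncontrolled process started from `s`: the urn after `n` draws. -/
def mPath (s : State) (u : Draws) : ℕ → State
  | 0 => s
  | n + 1 => step (mPath s u n) (u n)

/-- The process controlled by Policy A and started from `s`: the policy is applied at time `0` and
after every draw. -/
def aPath (s : State) (u : Draws) : ℕ → State
  | 0 => policyA s
  | n + 1 => policyA (step (aPath s u n) (u n))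

/-- The time of absorption of a path (`⊤` if the path is never absorbed). -/
def absorptionTime (p : ℕ → State) : ℕ∞ :=
  sInf ((fun n : ℕ => (n : ℕ∞)) '' {n : ℕ | Absorbed (p n)})

/-- The number of black balls at the time of absorption of a path. -/
def finalBlack (p : ℕ → State) : ℕ := (p (absorptionTime p).toNat).2

/-- Expected final number of black balls in the uncontrolled process from `w` white and `b` black
balls. -/
def V (w b : ℕ) : ℝ := ∫ u, (finalBlack (mPath (w, b) u) : ℝ) ∂drawLaw

/-- Expected final number of black balls in the process controlled by Policy A. -/
def VA (w b : ℕ) : ℝ := ∫ u, (finalBlack (aPath (w, b) u) : ℝ) ∂drawLaw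

/-- Expected time to absorption in the uncontrolled process, with values in `[0, ∞]`. -/
def T (w b : ℕ) : ENNReal := ∫⁻ u, (absorptionTime (mPath (w, b) u) : ENNReal) ∂drawLaw

/-- Expected time to absorption in the process controlled by Policy A, with values in `[0, ∞]`. -/
def TA (w b : ℕ) : ENNReal := ∫⁻ u, (absorptionTime (aPath (w, b) u) : ENNReal) ∂drawLaw

/-- The initial number `⌊(1 - x) N⌋` of white balls. -/
def initW (x : ℝ) (N : ℕ) : ℕ := ⌊(1 - x) * (N : ℝ)⌋₊

/-- The initial number `⌈x N⌉` of black balls. -/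
def initB (x : ℝ) (N : ℕ) : ℕ := ⌈x * (N : ℝ)⌉₊

end Mabinogion

end

/-!
While the black balls are at least `ρ > 1` times as many as the white ones, the exponential
`ρ ^ ((ρ w - b) / (1 + ρ))` is a supermartingale: a white draw multiplies it by `ρ`, a black draw
divides it by `ρ`. Started with a proportion `x > 1 / 2` of black balls it is exponentially small,
if `ρ < x / (1 - x)`, while it is at least `1` where the white balls are in majority. Hence by
Ville's inequality a white majority occurs only with exponentially small probability. Where none
occurs, a policy that acts on white majorities only never acts, and all balls end up black.

In the mean the lead `b - w` of the black balls grows by the factor `1 + 2 / n` per draw, which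
suggests `n / 2 * log (n / (b - w))` for the absorption time. The approximation may fail where the
black balls are fewer than `ρ` times the white ones, but there it is off by at most `n ^ 2`. So
adding or subtracting `n ^ 2` times the barrier, and a constant, gives functions that satisfy
Foster's drift conditions for every white-removing policy at once, and that differ from the
approximation by `o(n)` only.
-/

noncomputable section

namespace Mabinogion

section DrivenChain

open ProbabilityTheory

variable {S E : Type*}

/-- The chain started from `s` and driven by the innovations `u`: its step number `n` leads from
the state `t` to `K t (u n)`. For i.i.d. innovations this is a Markov chain. -/
def chain (K : S → E → S) (s : S) (u : ℕ → E) : ℕ → S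
  | 0 => s
  | n + 1 => K (chain K s u n) (u n)

open Classical in
/-- The transition map `K` stopped on `A`: the states in `A` become absorbing. -/
def stopOn (A : Set S) (K : S → E → S) (s : S) (v : E) : S := if s ∈ A then s else K s v

lemma stopOn_of_mem {A : Set S} {s : S} (hs : s ∈ A) (K : S → E → S) (v : E) :
    stopOn A K s v = s := if_pos hs

lemma stopOn_of_notMem {A : Set S} {s : S} (hs : s ∉ A) (K : S → E → S) (v : E) :
    stopOn A K s v = K s v := if_neg hs

lemma chain_stopOn_eq {A : Set S} {K : S → E → S} {s : S} {u : ℕ → E} {n : ℕ}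
    (h : ∀ k < n, chain K s u k ∉ A) : chain (stopOn A K) s u n = chain K s u n := by
  induction n with
  | zero => rfl
  | succ n ih =>
    rw [chain, ih fun k hk => h k (hk.trans n.lt_succ_self),
      stopOn_of_notMem (h n n.lt_succ_self), chain]

lemma chain_stopOn_mem_iff {A : Set S} {K : S → E → S} {s : S} {u : ℕ → E} {n : ℕ} :
    chain (stopOn A K) s u n ∈ A ↔ ∃ k ≤ n, chain K s u k ∈ A := by
  induction n with
  | zero => simp [chain]
  | succ n ih =>
    by_cases hn : chain (stopOn A K) s u n ∈ A
    · obtain ⟨k, hk, hkA⟩ := ih.1 hn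
      rw [chain, stopOn_of_mem hn]
      exact iff_of_true hn ⟨k, hk.trans n.le_succ, hkA⟩
    · have hlt : ∀ k < n + 1, chain K s u k ∉ A := fun k hk hkA =>
        hn (ih.2 ⟨k, Nat.le_of_lt_succ hk, hkA⟩)
      rw [chain_stopOn_eq hlt]
      refine ⟨fun h => ⟨n + 1, le_rfl, h⟩, fun ⟨k, hk, hkA⟩ => ?_⟩
      obtain rfl | hk := hk.eq_or_lt
      exacts [hkA, absurd hkA (hlt k hk)]

/-- The first time at which the path `p` visits `A`, and `⊤` if it never does. -/
def hitTime (A : Set S) (p : ℕ → S) : ℕ∞ :=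
  sInf ((fun n : ℕ => (n : ℕ∞)) '' {n : ℕ | p n ∈ A})

lemma hitTime_le_coe_iff {A : Set S} {p : ℕ → S} {n : ℕ} :
    hitTime A p ≤ n ↔ ∃ k ≤ n, p k ∈ A := by
  refine ⟨fun h => ?_, fun ⟨k, hk, hkA⟩ =>
    (show hitTime A p ≤ k from sInf_le ⟨k, hkA, rfl⟩).trans (Nat.cast_le.2 hk)⟩
  obtain ⟨_, ⟨k, hkA, rfl⟩, hk⟩ := sInf_lt_iff.1 (h.trans_lt (Nat.cast_lt.2 n.lt_succ_self))
  exact ⟨k, Nat.le_of_lt_succ (Nat.cast_lt.1 hk), hkA⟩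

lemma coe_le_hitTime_iff {A : Set S} {p : ℕ → S} {n : ℕ} :
    (n : ℕ∞) ≤ hitTime A p ↔ ∀ k < n, p k ∉ A := by
  simp only [hitTime, le_sInf_iff, Set.forall_mem_image, Set.mem_ofPred_eq, Nat.cast_le]
  exact forall_congr' fun k => ⟨fun h hk hkA => hk.not_ge (h hkA), fun h hkA => not_lt.1 fun hk =>
    h hk hkA⟩

lemma apply_toNat_hitTime_mem {A : Set S} {p : ℕ → S} (h : hitTime A p ≠ ⊤) :
    p (hitTime A p).toNat ∈ A := by
  obtain ⟨k, hk, hkA⟩ := hitTime_le_coe_iff.1 (ENat.natCast_toNat h).ge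
  have hle : (hitTime A p).toNat ≤ k :=
    ENat.toNat_le_of_le_natCast (hitTime_le_coe_iff.2 ⟨k, le_rfl, hkA⟩)
  rwa [hle.antisymm hk]

lemma coe_lt_hitTime_chain_iff {A : Set S} {K : S → E → S} {s : S} {u : ℕ → E} {n : ℕ} :
    (n : ℕ∞) < hitTime A (chain K s u) ↔ chain (stopOn A K) s u n ∉ A := by
  rw [← not_le, hitTime_le_coe_iff, chain_stopOn_mem_iff]

variable [MeasurableSpace S] [MeasurableSpace E]

lemma measurable_stopOn {A : Set S} (hA : MeasurableSet A) {K : S → E → S}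
    (hK : Measurable (Function.uncurry K)) : Measurable (Function.uncurry (stopOn A K)) :=
  Measurable.ite (measurable_fst hA) measurable_fst hK

lemma measurable_chain_of_forall_lt {Ω : Type*} [MeasurableSpace Ω] {K : S → E → S}
    (hK : Measurable (Function.uncurry K)) (s : S) {U : Ω → ℕ → E} {n : ℕ}
    (hU : ∀ k < n, Measurable fun ω => U ω k) : Measurable fun ω => chain K s (U ω) n := by
  induction n with
  | zero => exact measurable_const
  | succ n ih =>
    exact hK.comp ((ih fun k hk => hU k (hk.trans n.lt_succ_self)).prodMk (hU n n.lt_succ_self))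

lemma measurable_chain {K : S → E → S} (hK : Measurable (Function.uncurry K)) (s : S) (n : ℕ) :
    Measurable fun u => chain K s u n :=
  measurable_chain_of_forall_lt hK s fun k _ => measurable_pi_apply k

lemma measurable_hitTime {A : Set S} (hA : MeasurableSet A) :
    Measurable (hitTime A : (ℕ → S) → ℕ∞) := by
  have hle (n : ℕ) : MeasurableSet {p : ℕ → S | (n : ℕ∞) ≤ hitTime A p} := by
    simp only [coe_le_hitTime_iff, Set.ofPred_forall]
    exact .iInter fun k => .iInter fun _ => (measurable_pi_apply k hA).compl
  have hfiber (t : ℕ∞) :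
      hitTime A ⁻¹' {t} = ⋂ n : ℕ, {p | (n : ℕ∞) ≤ hitTime A p ↔ (n : ℕ∞) ≤ t} := by
    ext p
    simp only [Set.mem_preimage, Set.mem_singleton_iff, Set.mem_iInter, Set.mem_ofPred_eq]
    exact ⟨fun h n => h ▸ Iff.rfl, ENat.eq_of_forall_natCast_le_iff⟩
  refine measurable_to_countable' fun t => hfiber t ▸ .iInter fun n => ?_
  exact (hle n).iff (MeasurableSet.const _)

variable (μ : Measure E) {K : S → E → S}

lemma toENNReal_eq_tsum_indicator (m : ℕ∞) :
    (m : ENNReal) = ∑' n : ℕ, {n : ℕ | (n : ℕ∞) < m}.indicator 1 n := by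
  have hcard : {n : ℕ | (n : ℕ∞) < m}.encard = m := by
    cases m with
    | top => simp
    | coe m => simpa [Set.Iio] using Set.encard_coe_eq_coe_finsetCard (Finset.range m)
  rw [← tsum_subtype]
  simp only [Pi.one_apply, ENNReal.tsum_set_one, hcard]

lemma lintegral_hitTime_chain (hK : Measurable (Function.uncurry K)) {A : Set S}
    (hA : MeasurableSet A) (s : S) :
    ∫⁻ u, (hitTime A (chain K s u) : ENNReal) ∂(Measure.infinitePi fun _ : ℕ => μ) =
      ∑' n, ∫⁻ u, Aᶜ.indicator 1 (chain (stopOn A K) s u n)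
        ∂(Measure.infinitePi fun _ : ℕ => μ) := by
  have halive (n : ℕ) : Measurable fun u =>
      (Aᶜ.indicator 1 (chain (stopOn A K) s u n) : ENNReal) :=
    (measurable_one.indicator hA.compl).comp (measurable_chain (measurable_stopOn hA hK) s n)
  rw [← lintegral_tsum fun n => (halive n).aemeasurable]
  refine lintegral_congr fun u => ?_
  rw [toENNReal_eq_tsum_indicator]
  refine tsum_congr fun n => ?_
  simp only [coe_lt_hitTime_chain_iff]
  rfl

variable [IsProbabilityMeasure μ]

/-- The state at time `n` is a function of the innovations before time `n`. -/
lemma indepFun_chain_eval (hK : Measurable (Function.uncurry K)) (s : S) (n : ℕ) :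
    IndepFun (fun u => chain K s u n) (fun u => u n) (Measure.infinitePi fun _ : ℕ => μ) := by
  let m (k : ℕ) : MeasurableSpace (ℕ → E) := .comap (fun u => u k) inferInstance
  have hindep : iIndep m (Measure.infinitePi fun _ : ℕ => μ) :=
    iIndepFun_infinitePi (P := fun _ : ℕ => μ) (X := fun _ => id) fun _ => measurable_id
  have hle (k : ℕ) : m k ≤ MeasurableSpace.pi := (measurable_pi_apply k).comap_le
  have hpast : Measurable[⨆ k ∈ Set.Iio n, m k] fun u : ℕ → E => chain K s u n :=
    @measurable_chain_of_forall_lt _ _ _ _ _ (⨆ k ∈ Set.Iio n, m k) _ hK s id n fun k hk =>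
      (comap_measurable _).mono (le_biSup m hk) le_rfl
  have hsplit := indep_iSup_of_disjoint hle hindep
    (Set.disjoint_singleton_right.2 (Set.self_notMem_Iio (a := n)))
  rw [iSup_singleton] at hsplit
  exact indep_of_indep_of_le_left hsplit hpast.comap_le

lemma lintegral_chain_succ (hK : Measurable (Function.uncurry K)) {F : S → ENNReal}
    (hF : Measurable F) (s : S) (n : ℕ) :
    ∫⁻ u, F (chain K s u (n + 1)) ∂(Measure.infinitePi fun _ : ℕ => μ) =
      ∫⁻ u, ∫⁻ v, F (K (chain K s u n) v) ∂μ ∂(Measure.infinitePi fun _ : ℕ => μ) := by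
  have hX := measurable_chain hK s n
  have hFK : Measurable fun q : S × E => F (K q.1 q.2) := hF.comp hK
  have hprod := (indepFun_iff_map_prod_eq_prod_map_map hX.aemeasurable
    (measurable_pi_apply n).aemeasurable).1 (indepFun_chain_eval μ hK s n)
  rw [Measure.infinitePi_map_eval] at hprod
  calc _ = ∫⁻ q, F (K q.1 q.2) ∂(Measure.infinitePi fun _ : ℕ => μ).map
        fun u => (chain K s u n, u n) :=
        (lintegral_map hFK (hX.prodMk (measurable_pi_apply n))).symm
    _ = ∫⁻ t, ∫⁻ v, F (K t v) ∂μ ∂(Measure.infinitePi fun _ : ℕ => μ).map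
        fun u => chain K s u n := by
        rw [hprod, lintegral_prod _ hFK.aemeasurable]
    _ = _ := lintegral_map hFK.lintegral_prod_right' hX

lemma lintegral_chain_add_sum_le (hK : Measurable (Function.uncurry K)) {F g : S → ENNReal}
    (hF : Measurable F) (hg : Measurable g) (h : ∀ s, (∫⁻ v, F (K s v) ∂μ) + g s ≤ F s) (s : S)
    (n : ℕ) :
    (∫⁻ u, F (chain K s u n) ∂(Measure.infinitePi fun _ : ℕ => μ)) +
      ∑ k ∈ Finset.range n, ∫⁻ u, g (chain K s u k) ∂(Measure.infinitePi fun _ : ℕ => μ) ≤ F s := by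
  induction n with
  | zero => simp [chain]
  | succ n ih =>
    have hgn : Measurable fun u => g (chain K s u n) := hg.comp (measurable_chain hK s n)
    rw [Finset.sum_range_succ_comm, ← add_assoc, lintegral_chain_succ μ hK hF,
      ← lintegral_add_right _ hgn]
    refine le_trans ?_ ih
    gcongr with u
    exact h _

lemma le_lintegral_chain_add_sum (hK : Measurable (Function.uncurry K)) {F g : S → ENNReal}
    (hF : Measurable F) (hg : Measurable g) (h : ∀ s, F s ≤ (∫⁻ v, F (K s v) ∂μ) + g s) (s : S)
    (n : ℕ) :
    F s ≤ (∫⁻ u, F (chain K s u n) ∂(Measure.infinitePi fun _ : ℕ => μ)) +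
      ∑ k ∈ Finset.range n, ∫⁻ u, g (chain K s u k) ∂(Measure.infinitePi fun _ : ℕ => μ) := by
  induction n with
  | zero => simp [chain]
  | succ n ih =>
    have hgn : Measurable fun u => g (chain K s u n) := hg.comp (measurable_chain hK s n)
    rw [Finset.sum_range_succ_comm, ← add_assoc, lintegral_chain_succ μ hK hF,
      ← lintegral_add_right _ hgn]
    refine ih.trans ?_
    gcongr with u
    exact h _

/-- Ville's maximal inequality: `F` is a supermartingale along the chain stopped on `A`. -/
lemma measure_exists_chain_mem_le (hK : Measurable (Function.uncurry K)) {A : Set S}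
    (hA : MeasurableSet A) {F : S → ENNReal} (hF : Measurable F) (hFA : ∀ s ∈ A, 1 ≤ F s)
    (h : ∀ s ∉ A, ∫⁻ v, F (K s v) ∂μ ≤ F s) (s : S) :
    Measure.infinitePi (fun _ : ℕ => μ) {u | ∃ n, chain K s u n ∈ A} ≤ F s := by
  have hstopped (t : S) : (∫⁻ v, F (stopOn A K t v) ∂μ) + 0 ≤ F t := by
    by_cases ht : t ∈ A
    · simp [stopOn_of_mem ht]
    · simpa [stopOn_of_notMem ht] using h t ht
  have hmono : Monotone fun n => {u | chain (stopOn A K) s u n ∈ A} := fun m n hmn u hu => by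
    obtain ⟨k, hk, hkA⟩ := chain_stopOn_mem_iff.1 hu
    exact chain_stopOn_mem_iff.2 ⟨k, hk.trans hmn, hkA⟩
  have hunion : {u | ∃ n, chain K s u n ∈ A} = ⋃ n, {u | chain (stopOn A K) s u n ∈ A} := by
    ext u
    simp only [Set.mem_ofPred_eq, Set.mem_iUnion, chain_stopOn_mem_iff]
    exact ⟨fun ⟨n, hn⟩ => ⟨n, n, le_rfl, hn⟩, fun ⟨_, k, _, hk⟩ => ⟨k, hk⟩⟩
  rw [hunion, hmono.measure_iUnion]
  refine iSup_le fun n => ?_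
  have hK' := measurable_stopOn hA hK
  calc _ ≤ Measure.infinitePi (fun _ : ℕ => μ) {u | 1 ≤ F (chain (stopOn A K) s u n)} :=
        measure_mono fun u hu => hFA _ hu
    _ ≤ ∫⁻ u, F (chain (stopOn A K) s u n) ∂(Measure.infinitePi fun _ : ℕ => μ) := by
        simpa using mul_meas_ge_le_lintegral (hF.comp (measurable_chain hK' s n)) 1
    _ ≤ F s := by
        simpa using lintegral_chain_add_sum_le μ hK' hF measurable_zero hstopped s n

lemma lintegral_hitTime_chain_le (hK : Measurable (Function.uncurry K)) {A : Set S}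
    (hA : MeasurableSet A) {F : S → ENNReal} (hF : Measurable F)
    (h : ∀ s ∉ A, (∫⁻ v, F (K s v) ∂μ) + 1 ≤ F s) (s : S) :
    ∫⁻ u, (hitTime A (chain K s u) : ENNReal) ∂(Measure.infinitePi fun _ : ℕ => μ) ≤ F s := by
  have hstopped (t : S) : (∫⁻ v, F (stopOn A K t v) ∂μ) + Aᶜ.indicator 1 t ≤ F t := by
    by_cases ht : t ∈ A
    · simp [stopOn_of_mem ht, ht]
    · simpa [stopOn_of_notMem ht, ht] using h t ht
  rw [lintegral_hitTime_chain μ hK hA]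
  exact ENNReal.tsum_le_of_sum_range_le fun n => le_add_self.trans
    (lintegral_chain_add_sum_le μ (measurable_stopOn hA hK) hF
      (measurable_one.indicator hA.compl) hstopped s n)

lemma le_tsum_of_le_mul_add_sum {a : ℕ → ENNReal} {c M : ENNReal} (hM : M ≠ ⊤)
    (h : ∀ n, c ≤ M * a n + ∑ k ∈ Finset.range n, a k) : c ≤ ∑' n, a n := by
  rcases eq_or_ne (∑' n, a n) ⊤ with htop | htop
  · exact htop ▸ le_top
  have hlim := (ENNReal.Tendsto.const_mul (ENNReal.tendsto_atTop_zero_of_tsum_ne_top htop)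
    (Or.inr hM)).add (ENNReal.summable (f := a)).hasSum.tendsto_sum_nat
  rw [mul_zero, zero_add] at hlim
  exact ge_of_tendsto' hlim h

lemma le_lintegral_hitTime_chain (hK : Measurable (Function.uncurry K)) {A : Set S}
    (hA : MeasurableSet A) {F : S → ENNReal} (hF : Measurable F) (hFA : ∀ s ∈ A, F s = 0)
    (h : ∀ s ∉ A, F s ≤ (∫⁻ v, F (K s v) ∂μ) + 1) {s : S} {M : ENNReal} (hM : M ≠ ⊤)
    (hFM : ∀ u n, F (chain K s u n) ≤ M) :
    F s ≤ ∫⁻ u, (hitTime A (chain K s u) : ENNReal) ∂(Measure.infinitePi fun _ : ℕ => μ) := by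
  have hK' := measurable_stopOn hA hK
  have hg : Measurable (Aᶜ.indicator 1 : S → ENNReal) := measurable_one.indicator hA.compl
  have hstopped (t : S) : F t ≤ (∫⁻ v, F (stopOn A K t v) ∂μ) + Aᶜ.indicator 1 t := by
    by_cases ht : t ∈ A
    · simp [hFA t ht]
    · simpa [stopOn_of_notMem ht, ht] using h t ht
  have hbound (u : ℕ → E) (n : ℕ) :
      F (chain (stopOn A K) s u n) ≤ M * Aᶜ.indicator 1 (chain (stopOn A K) s u n) := by
    by_cases ht : chain (stopOn A K) s u n ∈ A
    · simp [hFA _ ht]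
    · have hne : ∀ k < n, chain K s u k ∉ A := fun k hk hkA =>
        ht (chain_stopOn_mem_iff.2 ⟨k, hk.le, hkA⟩)
      rw [Set.indicator_of_mem ht, chain_stopOn_eq hne]
      simpa using hFM u n
  rw [lintegral_hitTime_chain μ hK hA]
  refine le_tsum_of_le_mul_add_sum hM fun n => ?_
  refine (le_lintegral_chain_add_sum μ hK' hF hg hstopped s n).trans (add_le_add_left ?_ _)
  exact (lintegral_mono fun u => hbound u n).trans_eq
    (lintegral_const_mul _ (hg.comp (measurable_chain hK' s n)))

end DrivenChain

instance : IsProbabilityMeasure drawLaw := by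
  unfold drawLaw
  infer_instance

section Draw

/-- The number of balls in the urn, as a real number. -/
def total (s : State) : ℝ := s.1 + s.2

/-- The number of black balls minus the number of white balls. -/
def lead (s : State) : ℝ := s.2 - s.1

/-- The urn after a white ball has been drawn. -/
def drawWhite (s : State) : State := (s.1 + 1, s.2 - 1)

/-- The urn after a black ball has been drawn. -/
def drawBlack (s : State) : State := (s.1 - 1, s.2 + 1)

/-- The mean of `F` after one draw from the content `s`. Only a content that is not absorbed is
meant: for the others the subtractions in `drawWhite` and `drawBlack` truncate. -/
def meanAfterDraw (F : State → ℝ) (s : State) : ℝ :=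
  (s.1 * F (drawWhite s) + s.2 * F (drawBlack s)) / total s

variable {s : State}

lemma not_absorbed_iff : ¬ Absorbed s ↔ 0 < s.1 ∧ 0 < s.2 := by
  simp only [Absorbed, not_or, Nat.pos_iff_ne_zero]

lemma total_nonneg (s : State) : 0 ≤ total s := by
  unfold total
  positivity

lemma total_pos (hs : ¬ Absorbed s) : 0 < total s :=
  add_pos (Nat.cast_pos.2 (not_absorbed_iff.1 hs).1) (Nat.cast_pos.2 (not_absorbed_iff.1 hs).2)

lemma total_drawWhite (hs : ¬ Absorbed s) : total (drawWhite s) = total s := by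
  simp only [total, drawWhite, Nat.cast_add_one, Nat.cast_pred (not_absorbed_iff.1 hs).2]
  ring

lemma total_drawBlack (hs : ¬ Absorbed s) : total (drawBlack s) = total s := by
  simp only [total, drawBlack, Nat.cast_add_one, Nat.cast_pred (not_absorbed_iff.1 hs).1]
  ring

lemma lead_drawWhite (hs : ¬ Absorbed s) : lead (drawWhite s) = lead s - 2 := by
  simp only [lead, drawWhite, Nat.cast_add_one, Nat.cast_pred (not_absorbed_iff.1 hs).2]
  ring

lemma lead_drawBlack (hs : ¬ Absorbed s) : lead (drawBlack s) = lead s + 2 := by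
  simp only [lead, drawBlack, Nat.cast_add_one, Nat.cast_pred (not_absorbed_iff.1 hs).1]
  ring

lemma meanAfterDraw_mono {F G : State → ℝ} (h : ∀ t, F t ≤ G t) (s : State) :
    meanAfterDraw F s ≤ meanAfterDraw G s := by
  have := total_nonneg s
  unfold meanAfterDraw
  gcongr <;> exact h _

lemma meanAfterDraw_nonneg {F : State → ℝ} (h : ∀ t, 0 ≤ F t) (s : State) :
    0 ≤ meanAfterDraw F s :=
  div_nonneg (add_nonneg (mul_nonneg (Nat.cast_nonneg _) (h _))
    (mul_nonneg (Nat.cast_nonneg _) (h _))) (total_nonneg s)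

lemma meanAfterDraw_add (F G : State → ℝ) (s : State) :
    meanAfterDraw (fun t => F t + G t) s = meanAfterDraw F s + meanAfterDraw G s := by
  simp only [meanAfterDraw]
  ring

lemma meanAfterDraw_sub (F G : State → ℝ) (s : State) :
    meanAfterDraw (fun t => F t - G t) s = meanAfterDraw F s - meanAfterDraw G s := by
  simp only [meanAfterDraw]
  ring

lemma meanAfterDraw_total (hs : ¬ Absorbed s) (c : ℝ → ℝ) :
    meanAfterDraw (fun t => c (total t)) s = c (total s) := by
  have := (total_pos hs).ne'
  simp only [meanAfterDraw, total_drawWhite hs, total_drawBlack hs, ← add_mul]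
  exact mul_div_cancel_left₀ _ this

lemma meanAfterDraw_total_mul (hs : ¬ Absorbed s) (c : ℝ → ℝ) (F : State → ℝ) :
    meanAfterDraw (fun t => c (total t) * F t) s = c (total s) * meanAfterDraw F s := by
  simp only [meanAfterDraw, total_drawWhite hs, total_drawBlack hs]
  ring

lemma step_of_absorbed (hs : Absorbed s) (v : unitInterval) : step s v = s := if_pos hs

lemma step_of_not_absorbed (hs : ¬ Absorbed s) (v : unitInterval) :
    step s v = if (v : ℝ) * total s < s.1 then drawWhite s else drawBlack s := if_neg hs

lemma total_step (s : State) (v : unitInterval) : total (step s v) = total s := by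
  by_cases hs : Absorbed s
  · rw [step_of_absorbed hs]
  · rw [step_of_not_absorbed hs]
    split_ifs
    exacts [total_drawWhite hs, total_drawBlack hs]

lemma measurable_step (s : State) : Measurable (step s) := by
  unfold step
  split_ifs
  · exact measurable_const
  · exact .ite (measurableSet_lt (measurable_subtype_coe.mul_const _) measurable_const)
      measurable_const measurable_const

lemma volume_unitInterval_mul_lt {a t : ℝ} (ha : 0 ≤ a) (hat : a ≤ t) (ht : 0 < t) :
    (volume : Measure unitInterval) {v | (v : ℝ) * t < a} = ENNReal.ofReal (a / t) := by
  have h : {v : unitInterval | (v : ℝ) * t < a} =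
      Set.Iio ⟨a / t, div_nonneg ha ht.le, (div_le_one ht).2 hat⟩ := by
    ext v
    simp only [Set.mem_ofPred_eq, Set.mem_Iio, ← Subtype.coe_lt_coe, lt_div_iff₀ ht]
  rw [h, unitInterval.volume_Iio]

lemma lintegral_step (hs : ¬ Absorbed s) {F : State → ℝ} (hF : ∀ t, 0 ≤ F t) :
    ∫⁻ v, ENNReal.ofReal (F (step s v)) = ENNReal.ofReal (meanAfterDraw F s) := by
  have ht := total_pos hs
  let white : Set unitInterval := {v | (v : ℝ) * total s < s.1}
  have hwhite : MeasurableSet white :=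
    measurableSet_lt (measurable_subtype_coe.mul_const _) measurable_const
  have hvol : volume white = ENNReal.ofReal (s.1 / total s) :=
    volume_unitInterval_mul_lt (Nat.cast_nonneg _) (le_add_of_nonneg_right (Nat.cast_nonneg _)) ht
  have hvolc : volume whiteᶜ = ENNReal.ofReal (s.2 / total s) := by
    rw [prob_compl_eq_one_sub hwhite, hvol, ← ENNReal.ofReal_one,
      ← ENNReal.ofReal_sub _ (by positivity), one_sub_div ht.ne', total, add_sub_cancel_left]
  have hstep_white : ∀ v ∈ white,
      ENNReal.ofReal (F (step s v)) = ENNReal.ofReal (F (drawWhite s)) :=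
    fun v hv => by rw [(step_of_not_absorbed hs v).trans (if_pos hv)]
  have hstep_black : ∀ v ∈ whiteᶜ,
      ENNReal.ofReal (F (step s v)) = ENNReal.ofReal (F (drawBlack s)) :=
    fun v hv => by rw [(step_of_not_absorbed hs v).trans (if_neg hv)]
  rw [← lintegral_add_compl _ hwhite, setLIntegral_congr_fun hwhite hstep_white,
    setLIntegral_congr_fun hwhite.compl hstep_black, setLIntegral_const, setLIntegral_const, hvol,
    hvolc, ← ENNReal.ofReal_mul (hF _), ← ENNReal.ofReal_mul (hF _), ← ENNReal.ofReal_add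
      (mul_nonneg (hF _) (by positivity)) (mul_nonneg (hF _) (by positivity)), meanAfterDraw]
  congr 1
  ring

end Draw

section Policy

/-- The contents to which Policy A applies: the white balls are at least as many as the black
ones, and there is a black one. -/
def whiteMajority : Set State := {s | s.2 ≤ s.1 ∧ 0 < s.2}

/-- A policy that permanently removes white balls, and only while the whites are in majority in
the sense of `whiteMajority`. -/
structure IsWhiteRemoval (R : State → State) : Prop where
  fst_le (s : State) : (R s).1 ≤ s.1
  snd_eq (s : State) : (R s).2 = s.2
  eq_self {s : State} : s ∉ whiteMajority → R s = s

lemma isWhiteRemoval_id : IsWhiteRemoval id := ⟨fun _ => le_rfl, fun _ => rfl, fun _ => rfl⟩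

lemma isWhiteRemoval_policyA : IsWhiteRemoval policyA where
  fst_le s := by
    unfold policyA
    split_ifs with h
    exacts [(Nat.pred_le _).trans h.1, le_rfl]
  snd_eq s := by
    unfold policyA
    split_ifs <;> rfl
  eq_self h := if_neg h

/-- The process started from `s` and controlled by the policy `R`, which is applied at time `0`
and after every draw. -/
def controlledPath (R : State → State) (s : State) (u : Draws) : ℕ → State :=
  chain (fun t v => R (step t v)) (R s) u

/-- The expected time to absorption under the policy `R`. -/
def meanTime (R : State → State) (s : State) : ENNReal :=
  ∫⁻ u, (absorptionTime (controlledPath R s u) : ENNReal) ∂drawLaw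

/-- The expected final number of black balls under the policy `R`. -/
def meanFinalBlack (R : State → State) (s : State) : ℝ :=
  ∫ u, (finalBlack (controlledPath R s u) : ℝ) ∂drawLaw

lemma mPath_eq_controlledPath (s : State) (u : Draws) : mPath s u = controlledPath id s u := by
  ext1 n
  induction n with
  | zero => rfl
  | succ n ih => rw [mPath, ih]; rfl

lemma aPath_eq_controlledPath (s : State) (u : Draws) :
    aPath s u = controlledPath policyA s u := by
  ext1 n
  induction n with
  | zero => rfl
  | succ n ih => rw [aPath, ih]; rfl

lemma measurable_uncurry_comp_step (R : State → State) :
    Measurable (Function.uncurry fun t v => R (step t v)) :=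
  measurable_from_prod_countable_right fun t => (Measurable.of_discrete (f := R)).comp
    (measurable_step t)

lemma measurable_controlledPath (R : State → State) (s : State) (n : ℕ) :
    Measurable fun u => controlledPath R s u n :=
  measurable_chain (measurable_uncurry_comp_step R) (R s) n

variable {R : State → State} {s : State}

lemma IsWhiteRemoval.total_le (hR : IsWhiteRemoval R) (s : State) : total (R s) ≤ total s := by
  have := hR.fst_le s
  rw [total, total, hR.snd_eq]
  gcongr

lemma total_controlledPath_le (hR : IsWhiteRemoval R) (s : State) (u : Draws) (n : ℕ) :
    total (controlledPath R s u n) ≤ total s := by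
  induction n with
  | zero => exact hR.total_le s
  | succ n ih => exact (hR.total_le _).trans ((total_step _ _).trans_le ih)

lemma meanTime_le_of_drift {F : State → ℝ} (hF : ∀ t, 0 ≤ F t) (hFR : ∀ t, F (R t) ≤ F t)
    (hdrift : ∀ t, ¬ Absorbed t → meanAfterDraw F t + 1 ≤ F t) (s : State) :
    meanTime R s ≤ ENNReal.ofReal (F s) := by
  refine (lintegral_hitTime_chain_le (A := {t | Absorbed t}) volume
    (measurable_uncurry_comp_step R) .of_discrete
    (.of_discrete (f := fun t => ENNReal.ofReal (F t))) (fun t ht => ?_) (R s)).trans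
      (ENNReal.ofReal_le_ofReal (hFR s))
  calc (∫⁻ v, ENNReal.ofReal (F (R (step t v)))) + 1
      ≤ (∫⁻ v, ENNReal.ofReal (F (step t v))) + 1 := by
        gcongr with v
        exact hFR _
    _ ≤ ENNReal.ofReal (meanAfterDraw F t + 1) := by
        rw [lintegral_step ht hF, ENNReal.ofReal_add (meanAfterDraw_nonneg hF t) zero_le_one,
          ENNReal.ofReal_one]
    _ ≤ ENNReal.ofReal (F t) := ENNReal.ofReal_le_ofReal (hdrift t ht)

lemma le_meanTime_of_drift (hR : IsWhiteRemoval R) {F : State → ℝ} (hF : ∀ t, 0 ≤ F t)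
    (hFabs : ∀ t, Absorbed t → F t = 0) (hFR : ∀ t, F t ≤ F (R t))
    (hdrift : ∀ t, ¬ Absorbed t → F t ≤ meanAfterDraw F t + 1) {M : ℝ}
    (hM : ∀ t, total t ≤ total s → F t ≤ M) : ENNReal.ofReal (F s) ≤ meanTime R s := by
  refine (ENNReal.ofReal_le_ofReal (hFR s)).trans (le_lintegral_hitTime_chain
    (A := {t | Absorbed t}) volume (measurable_uncurry_comp_step R) .of_discrete
    (.of_discrete (f := fun t => ENNReal.ofReal (F t)))
    (fun t ht => ENNReal.ofReal_eq_zero.2 (hFabs t ht).le) (fun t ht => ?_) ENNReal.ofReal_ne_top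
    fun u n => ENNReal.ofReal_le_ofReal (hM _ (total_controlledPath_le hR s u n)))
  calc ENNReal.ofReal (F t) ≤ ENNReal.ofReal (meanAfterDraw F t + 1) :=
        ENNReal.ofReal_le_ofReal (hdrift t ht)
    _ = (∫⁻ v, ENNReal.ofReal (F (step t v))) + 1 := by
        rw [lintegral_step ht hF, ENNReal.ofReal_add (meanAfterDraw_nonneg hF t) zero_le_one,
          ENNReal.ofReal_one]
    _ ≤ (∫⁻ v, ENNReal.ofReal (F (R (step t v)))) + 1 := by
        gcongr with v
        exact hFR _

lemma drawLaw_exists_mPath_mem_le {A : Set State} {F : State → ℝ} (hF : ∀ t, 0 ≤ F t)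
    (hFA : ∀ t ∈ A, 1 ≤ F t) (hdrift : ∀ t, ¬ Absorbed t → meanAfterDraw F t ≤ F t) (s : State) :
    drawLaw {u | ∃ n, mPath s u n ∈ A} ≤ ENNReal.ofReal (F s) := by
  simp only [mPath_eq_controlledPath]
  refine measure_exists_chain_mem_le volume (measurable_uncurry_comp_step id) .of_discrete
    (.of_discrete (f := fun t => ENNReal.ofReal (F t)))
    (fun t ht => ENNReal.one_le_ofReal.2 (hFA t ht)) (fun t _ => ?_) s
  by_cases ht : Absorbed t
  · simp [step_of_absorbed ht]
  · exact (lintegral_step ht hF).trans_le (ENNReal.ofReal_le_ofReal (hdrift t ht))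

end Policy

section FinalBlack

variable {R : State → State} {s : State} {u : Draws}

lemma controlledPath_eq_mPath (hR : IsWhiteRemoval R) (h : ∀ n, mPath s u n ∉ whiteMajority)
    (n : ℕ) : controlledPath R s u n = mPath s u n := by
  induction n with
  | zero => exact hR.eq_self (h 0)
  | succ n ih =>
    rw [controlledPath, chain, ← controlledPath, ih]
    exact hR.eq_self (h (n + 1))

lemma total_mPath (s : State) (u : Draws) (n : ℕ) : total (mPath s u n) = total s := by
  induction n with
  | zero => rfl
  | succ n ih => rw [mPath, total_step, ih]

lemma mPath_snd_pos (hs : 0 < s.2) (h : ∀ n, mPath s u n ∉ whiteMajority) (n : ℕ) :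
    0 < (mPath s u n).2 := by
  induction n with
  | zero => exact hs
  | succ n ih =>
    by_cases habs : Absorbed (mPath s u n)
    · rwa [mPath, step_of_absorbed habs]
    · have hlt : (mPath s u n).1 < (mPath s u n).2 := not_le.1 fun hle => h n ⟨hle, ih⟩
      have hpos := (not_absorbed_iff.1 habs).1
      rw [mPath, step_of_not_absorbed habs]
      split_ifs
      exacts [Nat.sub_pos_of_lt (lt_of_le_of_lt hpos hlt), Nat.succ_pos _]

lemma finalBlack_le_total (hR : IsWhiteRemoval R) (s : State) (u : Draws) :
    (finalBlack (controlledPath R s u) : ℝ) ≤ total s :=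
  (le_add_of_nonneg_left (Nat.cast_nonneg _)).trans (total_controlledPath_le hR s u _)

lemma finalBlack_mPath (hs : 0 < s.2) (h : ∀ n, mPath s u n ∉ whiteMajority)
    (htop : absorptionTime (mPath s u) ≠ ⊤) : (finalBlack (mPath s u) : ℝ) = total s := by
  have habs : Absorbed (mPath s u (absorptionTime (mPath s u)).toNat) :=
    apply_toNat_hitTime_mem (A := {t | Absorbed t}) htop
  have hfst := habs.resolve_right (mPath_snd_pos hs h _).ne'
  rw [← total_mPath s u (absorptionTime (mPath s u)).toNat, total, hfst, Nat.cast_zero, zero_add,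
    finalBlack]

lemma measurable_absorptionTime_controlledPath (R : State → State) (s : State) :
    Measurable fun u => absorptionTime (controlledPath R s u) :=
  (measurable_hitTime (A := {t | Absorbed t}) .of_discrete).comp
    (measurable_pi_lambda _ fun n => measurable_controlledPath R s n)

lemma measurable_finalBlack_controlledPath (R : State → State) (s : State) :
    Measurable fun u => (finalBlack (controlledPath R s u) : ℝ) := by
  have hpath : Measurable fun q : ℕ × Draws => ((controlledPath R s q.2 q.1).2 : ℝ) :=
    measurable_from_prod_countable_right fun n =>
      (Measurable.of_discrete (f := fun t : State => (t.2 : ℝ))).comp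
        (measurable_controlledPath R s n)
  exact hpath.comp ((Measurable.of_discrete (f := ENat.toNat).comp
    (measurable_absorptionTime_controlledPath R s)).prodMk measurable_id)

lemma measurableSet_exists_mPath_mem (A : Set State) (s : State) :
    MeasurableSet {u | ∃ n, mPath s u n ∈ A} := by
  simp only [mPath_eq_controlledPath, Set.ofPred_exists]
  exact .iUnion fun n => measurable_controlledPath id s n .of_discrete

lemma integral_mem_Icc_of_eq_off {Ω : Type*} [MeasurableSpace Ω] {P : Measure Ω}
    [IsProbabilityMeasure P] {X : Ω → ℝ} (hX : AEStronglyMeasurable X P) {c : ℝ}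
    (hX0 : ∀ ω, 0 ≤ X ω) (hXc : ∀ ω, X ω ≤ c) {A : Set Ω} (hA : MeasurableSet A)
    (h : ∀ᵐ ω ∂P, ω ∉ A → X ω = c) : ∫ ω, X ω ∂P ∈ Set.Icc (c * (1 - P.real A)) c := by
  have hint : Integrable X P := .of_bound hX c (ae_of_all _ fun ω => by
    rw [Real.norm_of_nonneg (hX0 ω)]
    exact hXc ω)
  constructor
  · calc c * (1 - P.real A) = ∫ ω, Aᶜ.indicator (fun _ => c) ω ∂P := by
          rw [integral_indicator_const _ hA.compl, probReal_compl_eq_one_sub hA, smul_eq_mul,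
            mul_comm]
      _ ≤ ∫ ω, X ω ∂P := by
          refine integral_mono_ae ((integrable_const c).indicator hA.compl) hint ?_
          filter_upwards [h] with ω hω
          exact Set.indicator_apply_le' (fun hωA => (hω hωA).ge) fun _ => hX0 ω
  · simpa using integral_mono hint (integrable_const c) hXc

lemma meanFinalBlack_mem_Icc (hR : IsWhiteRemoval R) (hs : 0 < s.2) (hT : meanTime R s ≠ ⊤) :
    meanFinalBlack R s ∈ Set.Icc
      (total s * (1 - drawLaw.real {u | ∃ n, mPath s u n ∈ whiteMajority})) (total s) := by
  refine integral_mem_Icc_of_eq_off (measurable_finalBlack_controlledPath R s).aestronglyMeasurable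
    (fun _ => Nat.cast_nonneg _) (finalBlack_le_total hR s)
    (measurableSet_exists_mPath_mem whiteMajority s) ?_
  have hmeas : Measurable fun u => (absorptionTime (controlledPath R s u) : ENNReal) :=
    Measurable.of_discrete (f := ENat.toENNReal).comp
      (measurable_absorptionTime_controlledPath R s)
  filter_upwards [ae_lt_top hmeas hT] with u hu hmaj
  have hpath : controlledPath R s u = mPath s u :=
    funext (controlledPath_eq_mPath hR (not_exists.1 hmaj))
  rw [hpath] at hu ⊢
  exact finalBlack_mPath hs (not_exists.1 hmaj) (ENat.toENNReal_lt_top.1 hu).ne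

end FinalBlack

section Barrier

/-- The exponential barrier: a draw of a white ball multiplies it by `ρ`, a draw of a black ball
divides it by `ρ`, and it equals `1` where the black balls are `ρ` times as many as the white
ones. -/
def barrier (ρ : ℝ) (s : State) : ℝ := ρ ^ ((ρ * s.1 - s.2) / (1 + ρ))

variable {ρ : ℝ} {s : State}

lemma barrier_pos (hρ : 0 < ρ) (s : State) : 0 < barrier ρ s := Real.rpow_pos_of_pos hρ _

lemma one_le_barrier (hρ : 1 ≤ ρ) (hs : (s.2 : ℝ) ≤ ρ * s.1) : 1 ≤ barrier ρ s :=
  Real.one_le_rpow hρ (div_nonneg (sub_nonneg.2 hs) (by positivity))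

lemma barrier_drawWhite (hρ : 0 < ρ) (hs : ¬ Absorbed s) :
    barrier ρ (drawWhite s) = barrier ρ s * ρ := by
  rw [barrier, barrier, ← Real.rpow_add_one hρ.ne']
  congr 1
  simp only [drawWhite, Nat.cast_add_one, Nat.cast_pred (not_absorbed_iff.1 hs).2]
  field_simp
  ring

lemma barrier_drawBlack (hρ : 0 < ρ) (hs : ¬ Absorbed s) :
    barrier ρ (drawBlack s) = barrier ρ s / ρ := by
  rw [barrier, barrier, ← Real.rpow_sub_one hρ.ne']
  congr 1
  simp only [drawBlack, Nat.cast_add_one, Nat.cast_pred (not_absorbed_iff.1 hs).1]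
  field_simp
  ring

lemma meanAfterDraw_barrier_le (hρ : 1 ≤ ρ) (hs : ¬ Absorbed s) (h : ρ * s.1 ≤ s.2) :
    meanAfterDraw (barrier ρ) s ≤ barrier ρ s := by
  have hρ0 : 0 < ρ := zero_lt_one.trans_le hρ
  rw [meanAfterDraw, barrier_drawWhite hρ0 hs, barrier_drawBlack hρ0 hs, div_le_iff₀ (total_pos hs)]
  have hfactor : s.1 * ρ + s.2 / ρ ≤ total s := by
    rw [← sub_nonneg]
    have : total s - (s.1 * ρ + s.2 / ρ) = (ρ - 1) * (s.2 - ρ * s.1) / ρ := by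
      rw [total]
      field_simp
      ring
    rw [this]
    exact div_nonneg (mul_nonneg (sub_nonneg.2 hρ) (sub_nonneg.2 h)) hρ0.le
  calc _ = barrier ρ s * (s.1 * ρ + s.2 / ρ) := by ring
    _ ≤ _ := mul_le_mul_of_nonneg_left hfactor (barrier_pos hρ0 s).le

lemma le_mul_of_mem_whiteMajority (hρ : 1 ≤ ρ) (hs : s ∈ whiteMajority) : (s.2 : ℝ) ≤ ρ * s.1 :=
  (Nat.cast_le.2 hs.1).trans (le_mul_of_one_le_left (Nat.cast_nonneg _) hρ)

lemma drawLaw_exists_mem_whiteMajority_le (hρ : 1 ≤ ρ) (s : State) :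
    drawLaw {u | ∃ n, mPath s u n ∈ whiteMajority} ≤ ENNReal.ofReal (barrier ρ s) := by
  have hρ0 : 0 < ρ := zero_lt_one.trans_le hρ
  refine (drawLaw_exists_mPath_mem_le (F := fun t => min (barrier ρ t) 1)
    (fun t => le_min (barrier_pos hρ0 t).le zero_le_one)
    (fun t ht => le_min (one_le_barrier hρ (le_mul_of_mem_whiteMajority hρ ht)) le_rfl)
    (fun t ht => ?_) s).trans (ENNReal.ofReal_le_ofReal (min_le_left _ _))
  have hmean_one : meanAfterDraw (fun t => min (barrier ρ t) 1) t ≤ 1 :=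
    (meanAfterDraw_mono (fun t => min_le_right _ _) t).trans_eq
      (meanAfterDraw_total ht fun _ => 1)
  refine le_min ?_ hmean_one
  rcases le_total (ρ * t.1) t.2 with h | h
  · exact (meanAfterDraw_mono (fun t => min_le_left _ _) t).trans (meanAfterDraw_barrier_le hρ ht h)
  · exact hmean_one.trans (one_le_barrier hρ h)

end Barrier

section FluidTime

/-- The absorption time of the fluid limit: `lead` grows by the factor `1 + 2 / total` per draw in
the mean, and absorption takes place when it has reached `total`. -/
def fluidTime (s : State) : ℝ := total s / 2 * Real.log (total s / lead s)

lemma abs_lead_le_total (s : State) : |lead s| ≤ total s := by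
  have hw : (0 : ℝ) ≤ s.1 := Nat.cast_nonneg _
  have hb : (0 : ℝ) ≤ s.2 := Nat.cast_nonneg _
  unfold lead total
  exact abs_le.2 ⟨by linarith only [hb], by linarith only [hw]⟩

lemma one_le_abs_lead {s : State} (h : lead s ≠ 0) : 1 ≤ |lead s| := by
  have : (s.2 - s.1 : ℤ) ≠ 0 := by
    unfold lead at h
    exact_mod_cast h
  unfold lead
  exact_mod_cast Int.one_le_abs this

lemma log_total_div_lead_mem_Icc (s : State) :
    Real.log (total s / lead s) ∈ Set.Icc 0 (total s) := by
  have ht := total_nonneg s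
  rcases eq_or_ne (lead s) 0 with h | h
  · simpa [h] using ht
  · rw [← Real.log_abs, abs_div, abs_of_nonneg ht]
    exact ⟨Real.log_nonneg ((one_le_div (abs_pos.2 h)).2 (abs_lead_le_total s)),
      (Real.log_le_self (by positivity)).trans (div_le_self ht (one_le_abs_lead h))⟩

lemma fluidTime_nonneg (s : State) : 0 ≤ fluidTime s :=
  mul_nonneg (div_nonneg (total_nonneg s) zero_le_two) (log_total_div_lead_mem_Icc s).1

lemma fluidTime_le_sq (s : State) : fluidTime s ≤ total s ^ 2 := by
  have ht := total_nonneg s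
  calc fluidTime s ≤ total s * total s :=
        mul_le_mul (half_le_self ht) (log_total_div_lead_mem_Icc s).2
          (log_total_div_lead_mem_Icc s).1 ht
    _ = total s ^ 2 := (sq _).symm

lemma fluidTime_of_absorbed {s : State} (hs : Absorbed s) : fluidTime s = 0 := by
  have hlog : Real.log (total s / lead s) = 0 := by
    rcases hs with h | h
    · rcases eq_or_ne s.2 0 with h' | h' <;> simp [total, lead, h, h']
    · rcases eq_or_ne s.1 0 with h' | h' <;> simp [total, lead, h, h']
  rw [fluidTime, hlog, mul_zero]

lemma log_add_le {x t : ℝ} (hx : 0 < x) (ht : 0 < x + t) :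
    Real.log (x + t) ≤ Real.log x + t / x := by
  have h := Real.log_le_sub_one_of_pos (div_pos ht hx)
  rw [Real.log_div ht.ne' hx.ne', add_div, div_self hx.ne'] at h
  linarith

lemma le_log_add {x t : ℝ} (hx : 0 < x) (ht : 0 ≤ x + 2 * t) :
    Real.log x + t / x - 2 * (t / x) ^ 2 ≤ Real.log (x + t) := by
  have hxt : 0 < x + t := by linarith
  have hlog := Real.one_sub_inv_le_log_of_pos (div_pos hxt hx)
  rw [Real.log_div hxt.ne' hx.ne', inv_div] at hlog
  have hgap : 1 - x / (x + t) - (t / x - 2 * (t / x) ^ 2) =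
      t ^ 2 * (x + 2 * t) / (x ^ 2 * (x + t)) := by
    field_simp
    ring
  have hgap_nonneg : 0 ≤ t ^ 2 * (x + 2 * t) / (x ^ 2 * (x + t)) := by positivity
  linarith

variable {s : State}

lemma meanAfterDraw_log_lead_le (hs : ¬ Absorbed s) (h : 2 < lead s) :
    meanAfterDraw (fun t => Real.log (lead t)) s ≤ Real.log (lead s) + 2 / total s := by
  have hlead : 0 < lead s := by linarith
  have hwhite := log_add_le (t := -2) hlead (by linarith)
  have hblack := log_add_le (t := 2) hlead (by linarith)
  rw [meanAfterDraw, lead_drawWhite hs, lead_drawBlack hs, div_le_iff₀ (total_pos hs)]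
  calc s.1 * Real.log (lead s - 2) + s.2 * Real.log (lead s + 2)
      ≤ s.1 * (Real.log (lead s) + -2 / lead s) + s.2 * (Real.log (lead s) + 2 / lead s) := by
        gcongr
        exact hwhite
    _ = total s * Real.log (lead s) + 2 / lead s * (s.2 - s.1) := by
        rw [total]
        ring
    _ = (Real.log (lead s) + 2 / total s) * total s := by
        have := total_pos hs
        rw [← lead]
        field_simp

lemma le_meanAfterDraw_log_lead (hs : ¬ Absorbed s) (h : 4 ≤ lead s) :
    Real.log (lead s) + 2 / total s - 8 / lead s ^ 2 ≤
      meanAfterDraw (fun t => Real.log (lead t)) s := by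
  have hlead : 0 < lead s := by linarith
  have hwhite := le_log_add (t := -2) hlead (by linarith)
  have hblack := le_log_add (t := 2) hlead (by linarith)
  rw [meanAfterDraw, lead_drawWhite hs, lead_drawBlack hs, le_div_iff₀ (total_pos hs)]
  calc (Real.log (lead s) + 2 / total s - 8 / lead s ^ 2) * total s
      = total s * Real.log (lead s) + 2 / lead s * (s.2 - s.1) - 8 / lead s ^ 2 * total s := by
        have := total_pos hs
        rw [← lead]
        field_simp
    _ = s.1 * (Real.log (lead s) + -2 / lead s - 2 * (-2 / lead s) ^ 2) +
          s.2 * (Real.log (lead s) + 2 / lead s - 2 * (2 / lead s) ^ 2) := by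
        rw [total]
        ring
    _ ≤ s.1 * Real.log (lead s - 2) + s.2 * Real.log (lead s + 2) := by
        gcongr
        exact hwhite

lemma fluidTime_eq (ht : 0 < total s) (h : 0 < lead s) :
    fluidTime s = total s / 2 * (Real.log (total s) - Real.log (lead s)) := by
  rw [fluidTime, Real.log_div ht.ne' h.ne']

lemma meanAfterDraw_fluidTime (hs : ¬ Absorbed s) (h : 2 < lead s) :
    meanAfterDraw fluidTime s = total s / 2 *
      (Real.log (total s) - meanAfterDraw (fun t => Real.log (lead t)) s) := by
  have ht := total_pos hs
  rw [meanAfterDraw, fluidTime_eq, fluidTime_eq, meanAfterDraw, total_drawWhite hs,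
    total_drawBlack hs]
  · have hsum : total s = s.1 + s.2 := rfl
    field_simp
    rw [hsum]
    ring
  all_goals
    simp only [total_drawWhite hs, total_drawBlack hs, lead_drawWhite hs, lead_drawBlack hs]
    linarith

lemma fluidTime_le_meanAfterDraw (hs : ¬ Absorbed s) (h : 2 < lead s) :
    fluidTime s ≤ meanAfterDraw fluidTime s + 1 := by
  have ht := total_pos hs
  rw [meanAfterDraw_fluidTime hs h, fluidTime_eq ht (by linarith)]
  calc total s / 2 * (Real.log (total s) - Real.log (lead s))
      = total s / 2 * (Real.log (total s) - (Real.log (lead s) + 2 / total s)) + 1 := by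
        field_simp
        ring
    _ ≤ _ := by
        gcongr
        exact meanAfterDraw_log_lead_le hs h

lemma meanAfterDraw_fluidTime_le (hs : ¬ Absorbed s) (h : 4 ≤ lead s) :
    meanAfterDraw fluidTime s + 1 - 4 * total s / lead s ^ 2 ≤ fluidTime s := by
  have ht := total_pos hs
  have hlead : 0 < lead s := by linarith
  rw [meanAfterDraw_fluidTime hs (by linarith), fluidTime_eq ht hlead]
  calc total s / 2 * (Real.log (total s) - meanAfterDraw (fun t => Real.log (lead t)) s) + 1 -
        4 * total s / lead s ^ 2
      ≤ total s / 2 * (Real.log (total s) -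
          (Real.log (lead s) + 2 / total s - 8 / lead s ^ 2)) + 1 - 4 * total s / lead s ^ 2 := by
        gcongr
        exact le_meanAfterDraw_log_lead hs h
    _ = total s / 2 * (Real.log (total s) - Real.log (lead s)) := by
        field_simp
        ring

end FluidTime

section Drift

/-- Where the black balls are `ρ` times as many as the white ones, their lead is at least the
proportion `(ρ - 1) / (ρ + 1)` of all balls. By `meanAfterDraw_fluidTime_le` the Foster drift of
`fluidTime` then misses its target `1` by at most `fluidErrorConst ρ / (2 * total)`. -/
def fluidErrorConst (ρ : ℝ) : ℝ := 8 / ((ρ - 1) / (ρ + 1)) ^ 2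

/-- The contents for which the fluid approximation is good: the black balls are at least `ρ` times
as many as the white ones, and there are enough balls. -/
def fluidRegion (ρ : ℝ) : Set State := {s | ρ * s.1 ≤ s.2 ∧ fluidErrorConst ρ ≤ total s}

/-- The error with which `fluidTime` approximates the mean absorption time. Outside `fluidRegion` it
exceeds `total ^ 2`, which dominates both `fluidTime` and the mean absorption time. -/
def fluidError (ρ : ℝ) (s : State) : ℝ := total s ^ 2 * barrier ρ s + fluidErrorConst ρ ^ 2

variable {ρ : ℝ} {R : State → State} {s : State}

lemma fluidErrorConst_nonneg (ρ : ℝ) : 0 ≤ fluidErrorConst ρ := by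
  unfold fluidErrorConst
  positivity

lemma fluidError_nonneg (hρ : 0 < ρ) (s : State) : 0 ≤ fluidError ρ s := by
  have := barrier_pos hρ s
  unfold fluidError
  positivity

lemma mul_le_lead (hρ : 1 < ρ) (h : ρ * s.1 ≤ s.2) : (ρ - 1) / (ρ + 1) * total s ≤ lead s := by
  rw [div_mul_eq_mul_div, div_le_iff₀ (by linarith)]
  unfold total lead
  linarith

lemma four_le_lead (hρ : 1 < ρ) (h : s ∈ fluidRegion ρ) : 4 ≤ lead s := by
  have hδ : 0 < (ρ - 1) / (ρ + 1) := div_pos (by linarith) (by linarith)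
  have hδ1 : (ρ - 1) / (ρ + 1) ≤ 1 := (div_le_one (by linarith)).2 (by linarith)
  calc (4 : ℝ) ≤ 8 / ((ρ - 1) / (ρ + 1)) := by
        rw [le_div_iff₀ hδ]
        linarith
    _ = (ρ - 1) / (ρ + 1) * fluidErrorConst ρ := by
        unfold fluidErrorConst
        field_simp
    _ ≤ lead s := (mul_le_mul_of_nonneg_left h.2 hδ.le).trans (mul_le_lead hρ h.1)

lemma four_mul_total_div_sq_lead_le (hρ : 1 < ρ) (h : ρ * s.1 ≤ s.2) (hs : ¬ Absorbed s) :
    4 * total s / lead s ^ 2 ≤ fluidErrorConst ρ / (2 * total s) := by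
  have : 0 < (ρ - 1) / (ρ + 1) := div_pos (by linarith) (by linarith)
  have ht := total_pos hs
  calc 4 * total s / lead s ^ 2 ≤ 4 * total s / ((ρ - 1) / (ρ + 1) * total s) ^ 2 := by
        gcongr
        exact mul_le_lead hρ h
    _ = fluidErrorConst ρ / (2 * total s) := by
        unfold fluidErrorConst
        field_simp
        norm_num

lemma sq_total_le_fluidError (hρ : 1 < ρ) (h : s ∉ fluidRegion ρ) :
    total s ^ 2 ≤ fluidError ρ s := by
  rcases not_and_or.1 h with hmaj | hfew
  · exact (le_mul_of_one_le_right (sq_nonneg _) (one_le_barrier hρ.le (not_le.1 hmaj).le)).trans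
      (le_add_of_nonneg_right (sq_nonneg _))
  · exact (pow_le_pow_left₀ (total_nonneg s) (not_le.1 hfew).le 2).trans
      (le_add_of_nonneg_left (mul_nonneg (sq_nonneg _) (barrier_pos (by linarith) s).le))

lemma meanAfterDraw_fluidError_le (hρ : 1 ≤ ρ) (hs : ¬ Absorbed s) (h : ρ * s.1 ≤ s.2) :
    meanAfterDraw (fluidError ρ) s ≤ fluidError ρ s := by
  calc meanAfterDraw (fluidError ρ) s
      = total s ^ 2 * meanAfterDraw (barrier ρ) s + fluidErrorConst ρ ^ 2 := by
        unfold fluidError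
        rw [meanAfterDraw_add, meanAfterDraw_total_mul hs fun n => n ^ 2,
          meanAfterDraw_total hs fun _ => fluidErrorConst ρ ^ 2]
    _ ≤ fluidError ρ s := by
        unfold fluidError
        gcongr
        exact meanAfterDraw_barrier_le hρ hs h

lemma fluidTime_sub_fluidError_nonpos (hρ : 1 < ρ)
    (h : s ∉ fluidRegion ρ) : fluidTime s - fluidError ρ s ≤ 0 :=
  sub_nonpos.2 ((fluidTime_le_sq s).trans (sq_total_le_fluidError hρ h))

lemma notMem_fluidRegion (hρ : 1 < ρ) (hs : s ∈ whiteMajority) : s ∉ fluidRegion ρ := by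
  have hpos : (0 : ℝ) < s.1 := Nat.cast_pos.2 (hs.2.trans_le hs.1)
  exact fun h => h.1.not_gt ((Nat.cast_le.2 hs.1).trans_lt (lt_mul_of_one_lt_left hpos hρ))

lemma fluidTime_sub_fluidError_le_meanTime (hR : IsWhiteRemoval R) (hρ : 1 < ρ) (s : State) :
    ENNReal.ofReal (fluidTime s - fluidError ρ s) ≤ meanTime R s := by
  have hρ0 : 0 < ρ := by linarith
  let F (t : State) : ℝ := max (fluidTime t - fluidError ρ t) 0
  have hF_bad {t : State} (h : t ∉ fluidRegion ρ) : F t = 0 :=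
    max_eq_right (fluidTime_sub_fluidError_nonpos hρ h)
  have hF_nonneg (t : State) : 0 ≤ F t := le_max_right _ _
  refine (ENNReal.ofReal_le_ofReal (le_max_left _ _)).trans (le_meanTime_of_drift (F := F) hR
    hF_nonneg (fun t ht => ?_) (fun t => ?_) (fun t ht => ?_)
    (M := total s ^ 2) fun t ht => ?_)
  · exact max_eq_right (by simpa [fluidTime_of_absorbed ht] using fluidError_nonneg hρ0 t)
  · by_cases hmaj : t ∈ whiteMajority
    · rw [hF_bad (notMem_fluidRegion hρ hmaj)]
      exact hF_nonneg _
    · rw [hR.eq_self hmaj]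
  · by_cases h : t ∈ fluidRegion ρ
    · have hlead := four_le_lead hρ h
      have hmean : meanAfterDraw (fun t => fluidTime t - fluidError ρ t) t ≤ meanAfterDraw F t :=
        meanAfterDraw_mono (fun t => le_max_left _ _) t
      rw [meanAfterDraw_sub] at hmean
      have hfluid := fluidTime_le_meanAfterDraw ht (by linarith)
      have herror := meanAfterDraw_fluidError_le hρ.le ht h.1
      exact max_le (by linarith) (add_nonneg (meanAfterDraw_nonneg hF_nonneg t) zero_le_one)
    · rw [hF_bad h]
      exact add_nonneg (meanAfterDraw_nonneg hF_nonneg t) zero_le_one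
  · refine max_le ?_ (sq_nonneg _)
    have hsq := pow_le_pow_left₀ (total_nonneg t) ht 2
    linarith [fluidTime_le_sq t, fluidError_nonneg hρ0 t]

lemma meanAfterDraw_mul_add_one_le (hs : ¬ Absorbed s) :
    meanAfterDraw (fun t => (t.1 : ℝ) * t.2) s + 1 ≤ s.1 * s.2 := by
  obtain ⟨hw, hb⟩ := not_absorbed_iff.1 hs
  rw [← le_sub_iff_add_le, meanAfterDraw, div_le_iff₀ (total_pos hs)]
  simp only [drawWhite, drawBlack, total, Nat.cast_add_one, Nat.cast_pred hw, Nat.cast_pred hb]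
  linarith [sq_nonneg ((s.2 : ℝ) - s.1)]

lemma IsWhiteRemoval.mul_le (hR : IsWhiteRemoval R) (s : State) :
    ((R s).1 : ℝ) * (R s).2 ≤ s.1 * s.2 := by
  have := hR.fst_le s
  rw [hR.snd_eq]
  gcongr

lemma meanTime_le_mul (hR : IsWhiteRemoval R) (s : State) :
    meanTime R s ≤ ENNReal.ofReal (s.1 * s.2) :=
  meanTime_le_of_drift (F := fun t => (t.1 : ℝ) * t.2) (fun _ => by positivity) hR.mul_le
    (fun _ => meanAfterDraw_mul_add_one_le) s

lemma meanTime_ne_top (hR : IsWhiteRemoval R) (s : State) : meanTime R s ≠ ⊤ :=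
  ne_top_of_le_ne_top ENNReal.ofReal_ne_top (meanTime_le_mul hR s)

/-- An upper estimate of the mean absorption time: the factor makes up for the missing drift of
`fluidTime`. -/
def fluidUpper (ρ : ℝ) (s : State) : ℝ :=
  (1 + fluidErrorConst ρ / total s) * fluidTime s + fluidError ρ s

lemma fluidUpper_nonneg (hρ : 0 < ρ) (s : State) : 0 ≤ fluidUpper ρ s :=
  add_nonneg (mul_nonneg (add_nonneg zero_le_one (div_nonneg (fluidErrorConst_nonneg ρ)
    (total_nonneg s))) (fluidTime_nonneg s)) (fluidError_nonneg hρ s)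

lemma meanAfterDraw_fluidUpper_add_one_le (hρ : 1 < ρ) (hs : ¬ Absorbed s)
    (h : s ∈ fluidRegion ρ) :
    meanAfterDraw (fluidUpper ρ) s + 1 ≤ fluidUpper ρ s := by
  have ht := total_pos hs
  have hA := fluidErrorConst_nonneg ρ
  let r := fluidErrorConst ρ / total s
  have hr : 0 ≤ r := div_nonneg hA ht.le
  have hr1 : r ≤ 1 := (div_le_one ht).2 h.2
  have hdrift : meanAfterDraw fluidTime s + (1 - r / 2) ≤ fluidTime s := by
    have := meanAfterDraw_fluidTime_le hs (four_le_lead hρ h)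
    have := four_mul_total_div_sq_lead_le hρ h.1 hs
    have : fluidErrorConst ρ / (2 * total s) = r / 2 := by simp only [r]; field_simp
    linarith
  calc meanAfterDraw (fluidUpper ρ) s + 1
      = (1 + r) * meanAfterDraw fluidTime s + 1 + meanAfterDraw (fluidError ρ) s := by
        unfold fluidUpper
        rw [meanAfterDraw_add, meanAfterDraw_total_mul hs fun n => 1 + fluidErrorConst ρ / n]
        ring
    _ ≤ (1 + r) * (meanAfterDraw fluidTime s + (1 - r / 2)) + fluidError ρ s := by
        have := meanAfterDraw_fluidError_le hρ.le hs h.1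
        nlinarith
    _ ≤ fluidUpper ρ s := by
        unfold fluidUpper
        gcongr

lemma mul_le_fluidUpper (hρ : 1 < ρ) (h : s ∉ fluidRegion ρ) :
    (s.1 : ℝ) * s.2 ≤ fluidUpper ρ s := by
  have ht := total_nonneg s
  have hfluid := fluidTime_nonneg s
  have hA := fluidErrorConst_nonneg ρ
  calc (s.1 : ℝ) * s.2 ≤ total s ^ 2 := by
        unfold total
        nlinarith [mul_nonneg (s.1.cast_nonneg : (0 : ℝ) ≤ s.1) (s.2.cast_nonneg : (0 : ℝ) ≤ s.2)]
    _ ≤ fluidError ρ s := sq_total_le_fluidError hρ h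
    _ ≤ fluidUpper ρ s := le_add_of_nonneg_left (by positivity)

lemma meanTime_le_fluidUpper (hR : IsWhiteRemoval R) (hρ : 1 < ρ) (s : State) :
    meanTime R s ≤ ENNReal.ofReal (fluidUpper ρ s) := by
  let F (t : State) : ℝ := min (fluidUpper ρ t) (t.1 * t.2)
  have hF_bad {t : State} (h : t ∉ fluidRegion ρ) :
      F t = t.1 * t.2 := min_eq_right (mul_le_fluidUpper hρ h)
  refine (meanTime_le_of_drift (F := F) (fun t => ?_) (fun t => ?_) (fun t ht => ?_) s).trans
    (ENNReal.ofReal_le_ofReal (min_le_left _ _))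
  · exact le_min (fluidUpper_nonneg (by linarith) t) (by positivity)
  · by_cases hmaj : t ∈ whiteMajority
    · rw [hF_bad (notMem_fluidRegion hρ hmaj)]
      exact (min_le_right _ _).trans (hR.mul_le t)
    · rw [hR.eq_self hmaj]
  · have hmul : meanAfterDraw F t + 1 ≤ t.1 * t.2 :=
      (add_le_add_left (meanAfterDraw_mono (fun _ => min_le_right _ _) t) 1).trans
        (meanAfterDraw_mul_add_one_le ht)
    by_cases h : t ∈ fluidRegion ρ
    · exact le_min ((add_le_add_left (meanAfterDraw_mono (fun _ => min_le_left _ _) t) 1).trans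
        (meanAfterDraw_fluidUpper_add_one_le hρ ht h)) hmul
    · rwa [hF_bad h]

end Drift

section Asymptotics

lemma V_eq_meanFinalBlack (w b : ℕ) : V w b = meanFinalBlack id (w, b) := by
  simp only [V, meanFinalBlack, mPath_eq_controlledPath]

lemma VA_eq_meanFinalBlack (w b : ℕ) : VA w b = meanFinalBlack policyA (w, b) := by
  simp only [VA, meanFinalBlack, aPath_eq_controlledPath]

lemma T_eq_meanTime (w b : ℕ) : T w b = meanTime id (w, b) := by
  simp only [T, meanTime, mPath_eq_controlledPath]

lemma TA_eq_meanTime (w b : ℕ) : TA w b = meanTime policyA (w, b) := by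
  simp only [TA, meanTime, aPath_eq_controlledPath]

lemma isEquivalent_mul_of_tendsto_div {ι : Type*} {l : Filter ι} {f g : ι → ℝ} {c : ℝ} (hc : c ≠ 0)
    (hg : ∀ᶠ i in l, g i ≠ 0) (h : Tendsto (fun i => f i / g i) l (𝓝 c)) :
    f ~[l] fun i => g i * c := by
  have hmul := ((isEquivalent_const_iff_tendsto hc).2 h).mul (IsEquivalent.refl (u := g))
  refine (hmul.congr_left ?_).congr_right (.of_forall fun i => mul_comm c (g i))
  filter_upwards [hg] with i hi
  exact div_mul_cancel₀ (f i) hi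

variable {ι : Type*} {l : Filter ι} {s : ι → State} {x : ℝ}
  (htotal : Tendsto (fun i => total (s i)) l atTop)
  (hblack : Tendsto (fun i => (s i).2 / total (s i)) l (𝓝 x))

include htotal hblack

lemma tendsto_fst_div_total : Tendsto (fun i => (s i).1 / total (s i)) l (𝓝 (1 - x)) := by
  refine (hblack.const_sub 1).congr' ?_
  filter_upwards [htotal.eventually_gt_atTop 0] with i hi
  rw [one_sub_div hi.ne', total, add_sub_cancel_right]

lemma tendsto_lead_div_total : Tendsto (fun i => lead (s i) / total (s i)) l (𝓝 (2 * x - 1)) := by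
  have h := hblack.sub (tendsto_fst_div_total htotal hblack)
  rw [show x - (1 - x) = 2 * x - 1 by ring] at h
  exact h.congr fun i => (sub_div _ _ _).symm

lemma tendsto_total_pow_mul_barrier {ρ : ℝ} (hρ : 1 < ρ) (hx : ρ * (1 - x) < x) (k : ℕ) :
    Tendsto (fun i => total (s i) ^ k * barrier ρ (s i)) l (𝓝 0) := by
  have hρ0 : 0 < ρ := by linarith
  have hlim : (ρ * (1 - x) - x) / (1 + ρ) < 0 := div_neg_of_neg_of_pos (by linarith) (by linarith)
  obtain ⟨c, hc, hc0⟩ := exists_between hlim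
  have hrate : Tendsto (fun i => (ρ * ((s i).1 / total (s i)) - (s i).2 / total (s i)) / (1 + ρ)) l
      (𝓝 ((ρ * (1 - x) - x) / (1 + ρ))) :=
    (((tendsto_fst_div_total htotal hblack).const_mul ρ).sub hblack).div_const _
  have hexp := (tendsto_rpow_mul_exp_neg_mul_atTop_nhds_zero k (Real.log ρ * -c)
    (mul_pos (Real.log_pos hρ) (neg_pos.2 hc0))).comp htotal
  refine squeeze_zero' (.of_forall fun i => mul_nonneg (pow_nonneg (total_nonneg _) k)
    (barrier_pos hρ0 _).le) ?_ hexp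
  filter_upwards [hrate.eventually_lt_const hc, htotal.eventually_gt_atTop 0] with i hi hn
  have hexponent : (ρ * (s i).1 - (s i).2) / (1 + ρ) ≤ c * total (s i) := by
    rw [← div_le_iff₀ hn]
    refine le_of_eq_of_le ?_ hi.le
    field_simp
  rw [Function.comp_apply, Real.rpow_natCast, barrier, Real.rpow_def_of_pos hρ0]
  refine mul_le_mul_of_nonneg_left (Real.exp_le_exp.2 ?_) (pow_nonneg (total_nonneg _) k)
  calc Real.log ρ * ((ρ * (s i).1 - (s i).2) / (1 + ρ)) ≤ Real.log ρ * (c * total (s i)) := by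
        gcongr
        exact (Real.log_pos hρ).le
    _ = -(Real.log ρ * -c) * total (s i) := by ring

lemma tendsto_fluidError_div_total {ρ : ℝ} (hρ : 1 < ρ) (hx : ρ * (1 - x) < x) :
    Tendsto (fun i => fluidError ρ (s i) / total (s i)) l (𝓝 0) := by
  have h := (tendsto_total_pow_mul_barrier htotal hblack hρ hx 1).add
    (htotal.const_div_atTop (fluidErrorConst ρ ^ 2))
  rw [add_zero] at h
  refine h.congr' ?_
  filter_upwards [htotal.eventually_gt_atTop 0] with i hi
  unfold fluidError
  field_simp

lemma tendsto_fluidTime_div_total (hx : 1 / 2 < x) :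
    Tendsto (fun i => fluidTime (s i) / total (s i)) l (𝓝 (Real.log (1 / (2 * x - 1)) / 2)) := by
  have hlead := tendsto_lead_div_total htotal hblack
  have hlim : 2 * x - 1 ≠ 0 := by linarith
  have h := ((hlead.inv₀ hlim).log (inv_ne_zero hlim)).div_const 2
  rw [← one_div] at h
  refine h.congr' ?_
  filter_upwards [htotal.eventually_gt_atTop 0] with i hi
  rw [inv_div, fluidTime]
  field_simp

lemma tendsto_fluidUpper_div_total {ρ : ℝ} (hρ : 1 < ρ) (hx : 1 / 2 < x) (hρx : ρ * (1 - x) < x) :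
    Tendsto (fun i => fluidUpper ρ (s i) / total (s i)) l
      (𝓝 (Real.log (1 / (2 * x - 1)) / 2)) := by
  have h := (((htotal.const_div_atTop (fluidErrorConst ρ)).const_add 1).mul
    (tendsto_fluidTime_div_total htotal hblack hx)).add
      (tendsto_fluidError_div_total htotal hblack hρ hρx)
  rw [add_zero, add_zero, one_mul] at h
  refine h.congr fun i => ?_
  rw [fluidUpper, add_div, mul_div_assoc]

omit htotal hblack in
lemma exists_one_lt_mul_one_sub_lt (hx : 1 / 2 < x) (hx1 : x < 1) :
    ∃ ρ : ℝ, 1 < ρ ∧ ρ * (1 - x) < x := by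
  have h1x : 0 < 1 - x := by linarith
  obtain ⟨ρ, hρ, hρx⟩ := exists_between ((one_lt_div h1x).2 (by linarith : 1 - x < x))
  exact ⟨ρ, hρ, (lt_div_iff₀ h1x).1 hρx⟩

variable {R : State → State} (hR : IsWhiteRemoval R) (hx : 1 / 2 < x) (hx1 : x < 1)
include hR hx hx1

lemma isEquivalent_meanTime : (fun i => (meanTime R (s i)).toReal) ~[l]
    fun i => total (s i) / 2 * Real.log (1 / (2 * x - 1)) := by
  obtain ⟨ρ, hρ, hρx⟩ := exists_one_lt_mul_one_sub_lt hx hx1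
  have hlower := (tendsto_fluidTime_div_total htotal hblack hx).sub
    (tendsto_fluidError_div_total htotal hblack hρ hρx)
  rw [sub_zero] at hlower
  have hlim := tendsto_of_tendsto_of_tendsto_of_le_of_le hlower
    (tendsto_fluidUpper_div_total htotal hblack hρ hx hρx)
    (f := fun i => (meanTime R (s i)).toReal / total (s i))
    (fun i => (sub_div _ _ _).symm.trans_le (div_le_div_of_nonneg_right
      ((ENNReal.ofReal_le_iff_le_toReal (meanTime_ne_top hR _)).1
        (fluidTime_sub_fluidError_le_meanTime hR hρ _)) (total_nonneg _)))
    (fun i => div_le_div_of_nonneg_right (ENNReal.toReal_le_of_le_ofReal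
      (fluidUpper_nonneg (by linarith) _) (meanTime_le_fluidUpper hR hρ _)) (total_nonneg _))
  have hlog : 0 < Real.log (1 / (2 * x - 1)) :=
    Real.log_pos ((one_lt_div (by linarith)).2 (by linarith))
  refine (isEquivalent_mul_of_tendsto_div (half_pos hlog).ne' (htotal.eventually_ne_atTop 0)
    hlim).congr_right (.of_forall fun i => ?_)
  ring

omit hR in
lemma tendsto_drawLaw_exists_mem_whiteMajority :
    Tendsto (fun i => drawLaw {u | ∃ n, mPath (s i) u n ∈ whiteMajority}) l (𝓝 0) := by
  obtain ⟨ρ, hρ, hρx⟩ := exists_one_lt_mul_one_sub_lt hx hx1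
  have hbarrier : Tendsto (fun i => barrier ρ (s i)) l (𝓝 0) := by
    simpa using tendsto_total_pow_mul_barrier htotal hblack hρ hρx 0
  have hbound := ENNReal.tendsto_ofReal hbarrier
  rw [ENNReal.ofReal_zero] at hbound
  exact tendsto_of_tendsto_of_tendsto_of_le_of_le tendsto_const_nhds hbound (fun _ => bot_le)
    fun i => drawLaw_exists_mem_whiteMajority_le hρ.le (s i)

lemma isEquivalent_meanFinalBlack :
    (fun i => meanFinalBlack R (s i)) ~[l] fun i => total (s i) := by
  have hprob := (ENNReal.tendsto_toReal ENNReal.zero_ne_top).comp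
    (tendsto_drawLaw_exists_mem_whiteMajority htotal hblack hx hx1)
  have hlower := hprob.const_sub 1
  have hpos : ∀ᶠ i in l, 0 < (s i).2 := by
    filter_upwards [hblack.eventually_const_lt (by linarith : 0 < x)] with i hi
    exact Nat.pos_of_ne_zero fun h => by simp [h] at hi
  rw [ENNReal.toReal_zero, sub_zero] at hlower
  have hmem : ∀ᶠ i in l, meanFinalBlack R (s i) / total (s i) ∈ Set.Icc
      (1 - drawLaw.real {u | ∃ n, mPath (s i) u n ∈ whiteMajority}) 1 := by
    filter_upwards [htotal.eventually_gt_atTop 0, hpos] with i hi hb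
    obtain ⟨hle, hge⟩ := meanFinalBlack_mem_Icc hR hb (meanTime_ne_top hR _)
    exact ⟨(le_div_iff₀' hi).2 hle, (div_le_one hi).2 hge⟩
  have hlim := tendsto_of_tendsto_of_tendsto_of_le_of_le' hlower tendsto_const_nhds
    (hmem.mono fun _ h => h.1) (hmem.mono fun _ h => h.2)
  simpa using isEquivalent_mul_of_tendsto_div one_ne_zero (htotal.eventually_ne_atTop 0) hlim

lemma tendsto_drawLaw_controlledPath_eq_mPath :
    Tendsto (fun i => drawLaw {u | ∀ n, controlledPath R (s i) u n = mPath (s i) u n}) l (𝓝 1) := by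
  have hprob := tendsto_drawLaw_exists_mem_whiteMajority htotal hblack hx hx1
  have hlower := ENNReal.Tendsto.sub (tendsto_const_nhds (x := 1)) hprob (Or.inl ENNReal.one_ne_top)
  rw [tsub_zero] at hlower
  refine tendsto_of_tendsto_of_tendsto_of_le_of_le hlower tendsto_const_nhds (fun i => ?_)
    fun i => prob_le_one
  change 1 - drawLaw _ ≤ _
  rw [← prob_compl_eq_one_sub (measurableSet_exists_mPath_mem whiteMajority (s i))]
  exact measure_mono fun u hu => controlledPath_eq_mPath hR (not_exists.1 hu)

end Asymptotics

section InitialContent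

variable {x : ℝ}

lemma initW_add_initB (h0 : 0 ≤ x) (h1 : x ≤ 1) (N : ℕ) : initW x N + initB x N = N := by
  have hN : (0 : ℝ) ≤ N := N.cast_nonneg
  have hle : initB x N ≤ N := Nat.ceil_le.2 (mul_le_of_le_one_left hN h1)
  have hfloor : initW x N = N - initB x N := by
    have hceil := Nat.le_ceil (x * N)
    have hceil_lt := Nat.ceil_lt_add_one (mul_nonneg h0 hN)
    rw [← initB] at hceil hceil_lt
    rw [initW, Nat.floor_eq_iff (mul_nonneg (sub_nonneg.2 h1) hN), Nat.cast_sub hle]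
    constructor <;> linarith
  rw [hfloor, Nat.sub_add_cancel hle]

lemma total_initW_initB (h0 : 0 ≤ x) (h1 : x ≤ 1) (N : ℕ) : total (initW x N, initB x N) = N := by
  rw [total, ← Nat.cast_add, initW_add_initB h0 h1]

lemma tendsto_total_initW_initB (h0 : 0 ≤ x) (h1 : x ≤ 1) :
    Tendsto (fun N : ℕ => total (initW x N, initB x N)) atTop atTop := by
  simpa only [total_initW_initB h0 h1] using tendsto_natCast_atTop_atTop

lemma tendsto_initB_div_total (h0 : 0 ≤ x) (h1 : x ≤ 1) :
    Tendsto (fun N : ℕ => (initB x N : ℝ) / total (initW x N, initB x N)) atTop (𝓝 x) := by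
  simp only [total_initW_initB h0 h1]
  exact (tendsto_nat_ceil_mul_div_atTop h0).comp tendsto_natCast_atTop_atTop

end InitialContent

end Mabinogion

end

open Mabinogion in
theorem proposition5_general {R : State → State} (hR : IsWhiteRemoval R) {x : ℝ}
    (hx_half : 1 / 2 < x) (hx_one : x < 1) {ι : Type*} {l : Filter ι} {s : ι → State}
    (htotal : Tendsto (fun i => total (s i)) l atTop)
    (hblack : Tendsto (fun i => (s i).2 / total (s i)) l (𝓝 x)) :
    ((fun i => meanFinalBlack R (s i)) ~[l] fun i => V (s i).1 (s i).2) ∧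
    ((fun i => V (s i).1 (s i).2) ~[l] fun i => total (s i)) ∧
    (∀ i, meanTime R (s i) ≠ ⊤ ∧ T (s i).1 (s i).2 ≠ ⊤) ∧
    ((fun i => (meanTime R (s i)).toReal) ~[l] fun i => (T (s i).1 (s i).2).toReal) ∧
    ((fun i => (T (s i).1 (s i).2).toReal) ~[l]
      fun i => total (s i) / 2 * Real.log (1 / (2 * x - 1))) ∧
    Tendsto (fun i => drawLaw {u | ∀ n, controlledPath R (s i) u n = mPath (s i) u n}) l (𝓝 1) := by
  simp only [V_eq_meanFinalBlack, T_eq_meanTime]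
  have hblack_id := isEquivalent_meanFinalBlack htotal hblack isWhiteRemoval_id hx_half hx_one
  have htime_id := isEquivalent_meanTime htotal hblack isWhiteRemoval_id hx_half hx_one
  exact ⟨(isEquivalent_meanFinalBlack htotal hblack hR hx_half hx_one).trans hblack_id.symm,
    hblack_id, fun i => ⟨meanTime_ne_top hR _, meanTime_ne_top isWhiteRemoval_id _⟩,
    (isEquivalent_meanTime htotal hblack hR hx_half hx_one).trans htime_id.symm, htime_id,
    tendsto_drawLaw_controlledPath_eq_mPath htotal hblack hR hx_half hx_one⟩

theorem proposition5 (x : ℝ) (hx_half : 1 / 2 < x) (hx_one : x < 1) :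
    ((fun N : ℕ => Mabinogion.VA (Mabinogion.initW x N) (Mabinogion.initB x N)) ~[atTop]
      fun N : ℕ => Mabinogion.V (Mabinogion.initW x N) (Mabinogion.initB x N)) ∧
    ((fun N : ℕ => Mabinogion.V (Mabinogion.initW x N) (Mabinogion.initB x N)) ~[atTop]
      fun N : ℕ => (N : ℝ)) ∧
    (∀ N : ℕ, Mabinogion.TA (Mabinogion.initW x N) (Mabinogion.initB x N) ≠ ⊤ ∧
      Mabinogion.T (Mabinogion.initW x N) (Mabinogion.initB x N) ≠ ⊤) ∧
    ((fun N : ℕ => (Mabinogion.TA (Mabinogion.initW x N) (Mabinogion.initB x N)).toReal) ~[atTop]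
      fun N : ℕ => (Mabinogion.T (Mabinogion.initW x N) (Mabinogion.initB x N)).toReal) ∧
    ((fun N : ℕ => (Mabinogion.T (Mabinogion.initW x N) (Mabinogion.initB x N)).toReal) ~[atTop]
      fun N : ℕ => (N : ℝ) / 2 * Real.log (1 / (2 * x - 1))) ∧
    Tendsto (fun N : ℕ => Mabinogion.drawLaw {u : Mabinogion.Draws |
        ∀ n : ℕ, Mabinogion.aPath (Mabinogion.initW x N, Mabinogion.initB x N) u n =
          Mabinogion.mPath (Mabinogion.initW x N, Mabinogion.initB x N) u n})
      atTop (𝓝 1) := by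
  open Mabinogion in
  have h0 : 0 ≤ x := by linarith
  simpa only [VA_eq_meanFinalBlack, TA_eq_meanTime, aPath_eq_controlledPath,
    total_initW_initB h0 hx_one.le] using proposition5_general isWhiteRemoval_policyA hx_half hx_one
      (tendsto_total_initW_initB h0 hx_one.le) (tendsto_initB_div_total h0 hx_one.le)
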